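/- Let $n\ge 0$ and $m\ge 2$ be integers. Let $\mathbb{RP}^n=(\mathbb{R}^{n+1}\setminus\{0\})/\!\sim$, where $x\sim y$ if $x=\lambda y$ for some $\lambda\in\mathbb{R}\setminus\{0\}$, with its quotient topology and the smooth structure given by the standard affine charts, and let $\iota:\mathbb{R}^n\to\mathbb{RP}^n$, $\iota(x_1,\dots,x_n)=[x_1:\dots:x_n:1]$, be the canonical embedding. For an open set $\Omega$ in $\mathbb{R}^n$ or in $\mathbb{RP}^n$, a *$C^m$ defining function* for $\Omega$ is a real-valued $C^m$ function $\rho$ on an open neighborhood $U$ of $\partial\Omega$ such that $\{x\in U:\rho(x)<0\}=\Omega\cap U$ and $d\rho\neq 0$ at every point of $\partial\Omega$; $\Omega$ is a *$C^m$ domain* if it has a $C^m$ defining function (connectedness is not required). For $\Omega\subset\mathbb{R}^n$, a $C^m$ defining function $\rho$ on $U$ is *uniformly $C^m$* if 1. $\operatorname{dist}(\partial\Omega,\partial U)>0$ (with $\operatorname{dist}=\infty$ if one of the two sets is empty), 2. $\|\rho\|_{C^m(U)}<\infty$, that is, $\rho$ and its derivatives of order at most $m$ are bounded on $U$, 3.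 $\inf_U|\nabla\rho|>0$. **Corollary.** If $\tilde\Omega\subset\mathbb{RP}^n$ is a $C^m$ domain, then $\Omega=\iota^{-1}(\tilde\Omega)\subset\mathbb{R}^n$ has a uniformly $C^m$ defining function; that is, there are an open neighborhood $U$ of $\partial\Omega$ and a uniformly $C^m$ defining function $\rho$ for $\Omega$ on $U$. -/

import Mathlib

open scoped LinearAlgebra.Projectivization

/-- Real projective space `ℝℙⁿ = (ℝⁿ⁺¹ \ {0}) / ∼`, where `x ∼ y` iff `x = t y` for some `t ≠ 0`. -/
abbrev RPSpace (n : ℕ) : Type := ℙ ℝ (Fin (n + 1) → ℝ)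

/-- `ℝℙⁿ` carries the quotient topology of `ℝⁿ⁺¹ \ {0}`. -/
instance RPSpace.topologicalSpace (n : ℕ) : TopologicalSpace (RPSpace n) :=
  inferInstanceAs
    (TopologicalSpace (Quotient (projectivizationSetoid ℝ (Fin (n + 1) → ℝ))))

theorem insertNth_one_ne_zero {n : ℕ} (i : Fin (n + 1)) (x : Fin n → ℝ) :
    (Fin.insertNth i (1 : ℝ) x : Fin (n + 1) → ℝ) ≠ 0 := by
  intro h
  have h1 := congrFun h i
  simp at h1

/-- The inverse of the `i`-th standard affine coordinate chart of `ℝℙⁿ`: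
`(x₁, …, xₙ) ↦ [x₁ : … : 1 : … : xₙ]`, with the entry `1` inserted at position `i`.
Its image is the coordinate patch where the `i`-th homogeneous coordinate is nonzero. -/
noncomputable def RPSpace.affinePatch {n : ℕ} (i : Fin (n + 1)) (x : EuclideanSpace ℝ (Fin n)) : RPSpace n :=
  Projectivization.mk ℝ (Fin.insertNth i (1 : ℝ) (fun j => x j) : Fin (n + 1) → ℝ)
    (insertNth_one_ne_zero i (fun j => x j))

/-- The canonical embedding `ℝⁿ → ℝℙⁿ`, `(x₁, …, xₙ) ↦ [x₁ : … : xₙ : 1]`. -/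
noncomputable def RPSpace.canonicalEmbedding {n : ℕ} (x : EuclideanSpace ℝ (Fin n)) : RPSpace n :=
  RPSpace.affinePatch (Fin.last n) x

theorem RPSpace.canonicalEmbedding_eq_snoc {n : ℕ} (x : EuclideanSpace ℝ (Fin n))
    (h : (Fin.snoc (fun j => x j) (1 : ℝ) : Fin (n + 1) → ℝ) ≠ 0) :
    RPSpace.canonicalEmbedding x =
      Projectivization.mk ℝ (Fin.snoc (fun j => x j) (1 : ℝ) : Fin (n + 1) → ℝ) h := by
  simp only [RPSpace.canonicalEmbedding, RPSpace.affinePatch, Fin.insertNth_last']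

/-- `ρ` is a `C^m` defining function, on the open neighbourhood `U` of the boundary, for the open
set `Ω ⊂ ℝℙⁿ`. Being `C^m` and having nonvanishing differential are expressed in the standard
affine charts. Only the values of `ρ` on `U` matter. -/
structure RPSpace.IsDefiningFunction {n : ℕ} (m : ℕ) (Ω U : Set (RPSpace n))
    (ρ : RPSpace n → ℝ) : Prop where
  isOpen_domain : IsOpen Ω
  isOpen_nhd : IsOpen U
  frontier_subset : frontier Ω ⊆ U
  contDiffOn : ∀ i : Fin (n + 1),
    ContDiffOn ℝ m (ρ ∘ RPSpace.affinePatch i) (RPSpace.affinePatch i ⁻¹' U)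
  neg_iff : {p ∈ U | ρ p < 0} = Ω ∩ U
  differential_ne_zero : ∀ (i : Fin (n + 1)) (x : EuclideanSpace ℝ (Fin n)),
    RPSpace.affinePatch i x ∈ frontier Ω → fderiv ℝ (ρ ∘ RPSpace.affinePatch i) x ≠ 0

/-- `Ω` is a `C^m` domain in `ℝℙⁿ`: an open set that has a `C^m` defining function
(connectedness is not required). -/
def RPSpace.IsCmDomain {n : ℕ} (m : ℕ) (Ω : Set (RPSpace n)) : Prop :=
  ∃ (U : Set (RPSpace n)) (ρ : RPSpace n → ℝ), RPSpace.IsDefiningFunction m Ω U ρ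

/-- `ρ` is a `C^m` defining function, on the open neighbourhood `U` of the boundary, for the open
set `Ω ⊂ ℝⁿ`. Only the values of `ρ` on `U` matter. -/
structure IsDefiningFunction {n : ℕ} (m : ℕ) (Ω U : Set (EuclideanSpace ℝ (Fin n)))
    (ρ : EuclideanSpace ℝ (Fin n) → ℝ) : Prop where
  isOpen_domain : IsOpen Ω
  isOpen_nhd : IsOpen U
  frontier_subset : frontier Ω ⊆ U
  contDiffOn : ContDiffOn ℝ m ρ U
  neg_iff : {x ∈ U | ρ x < 0} = Ω ∩ U
  gradient_ne_zero : ∀ x ∈ frontier Ω, gradient ρ x ≠ 0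

/-- `ρ` is a uniformly `C^m` defining function for `Ω ⊂ ℝⁿ` on `U`:
`dist (∂Ω, ∂U) > 0` (vacuous if one of the boundaries is empty), the `C^m (U)` norm of `ρ` is
finite, and `inf_U |∇ρ| > 0`. -/
structure IsUniformDefiningFunction {n : ℕ} (m : ℕ) (Ω U : Set (EuclideanSpace ℝ (Fin n)))
    (ρ : EuclideanSpace ℝ (Fin n) → ℝ) : Prop extends IsDefiningFunction m Ω U ρ where
  dist_pos : ∃ c : ℝ, 0 < c ∧ ∀ x ∈ frontier Ω, ∀ y ∈ frontier U, c ≤ dist x y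
  norm_finite : ∃ C : ℝ, ∀ k : ℕ, k ≤ m → ∀ x ∈ U, ‖iteratedFDeriv ℝ k ρ x‖ ≤ C
  gradient_bound : ∃ c : ℝ, 0 < c ∧ ∀ x ∈ U, c ≤ ‖gradient ρ x‖

/-!
Let `ρ'` be a `C^m` defining function for `Ω'` and `f = ρ' ∘ ι` its expression on `ℝⁿ`. Near `∂Ω`
the function `f` has the right sign and is `C^m`, but its differential may tend to zero at infinity,
as it does where `∂Ω'` is tangent to the hyperplane at infinity. The remedy is to divide `f` by a
weight comparable to `‖df‖`.

The lift `F` of `ρ'` to homogeneous coordinates is homogeneous of degree zero, and `f` is the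
restriction of `F` to the hyperplane `{t = 1}`. By compactness of the unit sphere, the derivatives of
`F` are bounded near the unit vectors lying over `∂Ω'`, and `‖dF‖` is bounded below there. At a
boundary point `s`, put `R = ‖(s, 1)‖`. Scaling gives `‖Dᵏf‖ ≤ C R⁻ᵏ` on a ball about `s` of fixed
radius, while Euler's relation `dF(u) u = 0` prevents `dF` from being concentrated on the direction
transversal to the hyperplane and gives `‖df(s)‖ ≥ c R⁻²`. Hence `‖Dᵏf‖ ≤ C' ‖df(s)‖` on that ball
for `2 ≤ k ≤ m` (`exists_bounds_restrict_hyperplane`).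

Such a function can be renormalised (`exists_uniform_renormalization`). The quotient `f / ‖∇f‖` would
only be of class `C^(m-1)`, so the gradient is replaced by its forward-difference approximation `q`
with a small fixed step `δ`. By the bound on the second derivatives, `‖q‖` is close to `‖df(s)‖` on
the ball of radius `δ` about `s`, and the derivatives of `q` up to order `m` are controlled by
`‖df(s)‖` as well. After division by `‖df(s)‖`, which does not affect `f / ‖q‖`, all the constants
are independent of `s` (`exists_uniform_bounds_of_norm_fderiv_eq_one`). The function `f / ‖q‖` on the
`δ`-neighbourhood of `∂Ω` is the uniformly `C^m` defining function.
-/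

open Metric

/-! ### Estimates for iterated derivatives, and the forward-difference gradient -/

section Calculus

variable {E : Type*} [NormedAddCommGroup E] [NormedSpace ℝ E]
  {F : Type*} [NormedAddCommGroup F] [NormedSpace ℝ F]

theorem norm_fderiv_fderiv (f : E → F) (x : E) :
    ‖fderiv ℝ (fderiv ℝ f) x‖ = ‖iteratedFDeriv ℝ 2 f x‖ := by
  rw [← norm_iteratedFDeriv_one, norm_iteratedFDeriv_fderiv]

theorem norm_iteratedFDeriv_one_sub_le (f : E → F) (x y : E) :
    ‖iteratedFDeriv ℝ 1 f y - iteratedFDeriv ℝ 1 f x‖ ≤ ‖fderiv ℝ f y - fderiv ℝ f x‖ := by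
  refine ContinuousMultilinearMap.opNorm_le_bound (norm_nonneg _) fun v => ?_
  rw [sub_apply, iteratedFDeriv_one_apply, iteratedFDeriv_one_apply,
    ← sub_apply]
  simpa using (fderiv ℝ f y - fderiv ℝ f x).le_opNorm (v 0)

theorem norm_fderiv_sub_fderiv_le {f : E → F} {s : E} {r C : ℝ}
    (hf : ContDiffOn ℝ 2 f (ball s r))
    (hC : ∀ x ∈ ball s r, ‖iteratedFDeriv ℝ 2 f x‖ ≤ C) {x y : E}
    (hx : x ∈ ball s r) (hy : y ∈ ball s r) :
    ‖fderiv ℝ f y - fderiv ℝ f x‖ ≤ C * ‖y - x‖ := by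
  have h1 : ContDiffOn ℝ 1 (fderiv ℝ f) (ball s r) :=
    hf.fderiv_of_isOpen isOpen_ball (by norm_num)
  refine (convex_ball s r).norm_image_sub_le_of_norm_fderiv_le (𝕜 := ℝ) (fun z hz => ?_)
    (fun z hz => ?_) hx hy
  · exact (h1.contDiffAt (isOpen_ball.mem_nhds hz)).differentiableAt (by norm_num)
  · rw [norm_fderiv_fderiv]; exact hC z hz

theorem iteratedFDeriv_fun_sum_apply_of_contDiffAt {ι : Type*} {u : Finset ι} {f : ι → E → F} {k : ℕ} {x : E}
    (h : ∀ j ∈ u, ContDiffAt ℝ k (f j) x) :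
    iteratedFDeriv ℝ k (fun y => ∑ j ∈ u, f j y) x = ∑ j ∈ u, iteratedFDeriv ℝ k (f j) x := by
  classical
  induction u using Finset.induction_on with
  | empty =>
    simp only [Finset.sum_empty]
    exact congrFun (iteratedFDeriv_fun_zero (𝕜 := ℝ) (E := E) (F := F) (n := k)) x
  | insert a u ha ih =>
    simp only [Finset.sum_insert ha]
    have := iteratedFDeriv_add_apply (𝕜 := ℝ) (i := k) (f := f a) (g := fun y => ∑ j ∈ u, f j y)
      (x := x) (h a (by simp)) (ContDiffAt.sum fun j hj => h j (by simp [hj]))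
    rw [← ih fun j hj => h j (by simp [hj])]
    exact this

/-- Pointwise form of the Leibniz estimate for two factors that are bounded on an open set. -/
theorem norm_iteratedFDeriv_mul_le_of_bound {f g : E → ℝ} {s : Set E} (hs : IsOpen s) {m : ℕ}
    (hf : ContDiffOn ℝ m f s) (hg : ContDiffOn ℝ m g s) {x : E} (hx : x ∈ s) {A B : ℝ}
    (hA : ∀ k ≤ m, ‖iteratedFDeriv ℝ k f x‖ ≤ A)
    (hB : ∀ k ≤ m, ‖iteratedFDeriv ℝ k g x‖ ≤ B) {k : ℕ} (hk : k ≤ m) :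
    ‖iteratedFDeriv ℝ k (fun y => f y * g y) x‖ ≤ 2 ^ m * A * B := by
  have hA0 : 0 ≤ A := (norm_nonneg _).trans (hA 0 (Nat.zero_le _))
  have hB0 : 0 ≤ B := (norm_nonneg _).trans (hB 0 (Nat.zero_le _))
  have h := norm_iteratedFDerivWithin_mul_le hf hg hs.uniqueDiffOn hx (n := k) (by exact_mod_cast hk)
  rw [iteratedFDerivWithin_of_isOpen k hs hx] at h
  refine h.trans ?_
  calc _ ≤ ∑ i ∈ Finset.range (k + 1), (k.choose i : ℝ) * A * B := by
        refine Finset.sum_le_sum fun i hi => ?_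
        have hi' : i ≤ k := Nat.lt_succ_iff.mp (Finset.mem_range.mp hi)
        rw [iteratedFDerivWithin_of_isOpen i hs hx, iteratedFDerivWithin_of_isOpen (k - i) hs hx]
        gcongr
        · exact hA i (hi'.trans hk)
        · exact hB _ ((Nat.sub_le _ _).trans hk)
    _ = 2 ^ k * A * B := by
        rw [← Finset.sum_mul, ← Finset.sum_mul]
        congr 2
        exact_mod_cast Nat.sum_range_choose k
    _ ≤ _ := by gcongr; norm_num

end Calculus

section ForwardDifference

variable {E : Type*} [NormedAddCommGroup E] [InnerProductSpace ℝ E] {ι : Type*} [Fintype ι]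

/-- The forward-difference approximation, with step `δ`, of the gradient of `f`.
Unlike the gradient itself it is as differentiable as `f` is. -/
noncomputable def forwardDiffGradient (b : OrthonormalBasis ι ℝ E) (δ : ℝ) (f : E → ℝ) (x : E) : E :=
  ∑ i, (δ⁻¹ * (f (x + δ • b i) - f x)) • b i

variable (b : OrthonormalBasis ι ℝ E)

theorem forwardDiffGradient_const_mul (δ c : ℝ) (f : E → ℝ) (x : E) :
    forwardDiffGradient b δ (fun y => c * f y) x = c • forwardDiffGradient b δ f x := by
  simp only [forwardDiffGradient, Finset.smul_sum, smul_smul]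
  refine Finset.sum_congr rfl fun i _ => ?_
  congr 1; ring

variable {b}

theorem add_smul_mem_ball {s x : E} {r δ : ℝ} (hδ : 0 < δ) (hr : 2 * δ ≤ r) (hx : x ∈ ball s δ)
    (i : ι) : x + δ • b i ∈ ball s r := by
  rw [mem_ball, dist_eq_norm] at *
  calc ‖x + δ • b i - s‖ = ‖(x - s) + δ • b i‖ := by congr 1; abel
    _ ≤ ‖x - s‖ + ‖δ • b i‖ := norm_add_le _ _
    _ < δ + δ := by
        rw [norm_smul, b.orthonormal.1 i, mul_one, Real.norm_of_nonneg hδ.le]; linarith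
    _ ≤ r := by linarith

theorem contDiffAt_forwardDiffGradient {f : E → ℝ} {s x : E} {r δ : ℝ} {m : ℕ}
    (hf : ContDiffOn ℝ m f (ball s r)) (hδ : 0 < δ) (hr : 2 * δ ≤ r) (hx : x ∈ ball s δ) :
    ContDiffAt ℝ m (forwardDiffGradient b δ f) x := by
  have hx' : x ∈ ball s r := ball_subset_ball (by linarith) hx
  refine ContDiffAt.sum fun i _ => ContDiffAt.smul (contDiffAt_const.mul (ContDiffAt.sub ?_ ?_))
    contDiffAt_const
  · exact ContDiffAt.comp x (hf.contDiffAt (isOpen_ball.mem_nhds (add_smul_mem_ball hδ hr hx i)))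
      (contDiffAt_id.add contDiffAt_const)
  · exact hf.contDiffAt (isOpen_ball.mem_nhds hx')

/-- A bound `D` for the increments of `Dᵏf` bounds `Dᵏ` of the forward-difference gradient. No
derivative of `f` of order `k + 1` enters, which is what makes the estimate usable for `k = m`. -/
theorem norm_iteratedFDeriv_forwardDiffGradient_le {f : E → ℝ} {s x : E} {r δ D : ℝ} {m k : ℕ}
    (hf : ContDiffOn ℝ m f (ball s r)) (hδ : 0 < δ) (hr : 2 * δ ≤ r) (hx : x ∈ ball s δ)
    (hk : k ≤ m)
    (hD : ∀ i, ‖iteratedFDeriv ℝ k f (x + δ • b i) - iteratedFDeriv ℝ k f x‖ ≤ D) :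
    ‖iteratedFDeriv ℝ k (forwardDiffGradient b δ f) x‖ ≤ Fintype.card ι * (δ⁻¹ * D) := by
  have hkm : (k : WithTop ℕ∞) ≤ m := by exact_mod_cast hk
  have hx' : x ∈ ball s r := ball_subset_ball (by linarith) hx
  have hf1 : ContDiffAt ℝ k f x := (hf.contDiffAt (isOpen_ball.mem_nhds hx')).of_le hkm
  have hf2 : ∀ i, ContDiffAt ℝ k (fun y => f (y + δ • b i)) x := fun i =>
    (ContDiffAt.comp x (hf.contDiffAt (isOpen_ball.mem_nhds (add_smul_mem_ball hδ hr hx i)))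
      (contDiffAt_id.add contDiffAt_const)).of_le hkm
  have hq : ∀ i, ContDiffAt ℝ k (δ⁻¹ • ((fun y => f (y + δ • b i)) - f)) x := fun i =>
    contDiffAt_const.smul ((hf2 i).sub hf1)
  have hsum : forwardDiffGradient b δ f = fun y => ∑ i, (ContinuousLinearMap.toSpanSingleton ℝ (b i) ∘
      (δ⁻¹ • ((fun y => f (y + δ • b i)) - f))) y := by
    funext y
    simp [forwardDiffGradient, ContinuousLinearMap.toSpanSingleton_apply]
  rw [hsum, iteratedFDeriv_fun_sum_apply_of_contDiffAt fun i _ =>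
    (ContinuousLinearMap.contDiff _).contDiffAt.comp x (hq i)]
  refine (norm_sum_le_of_le (n := fun _ => δ⁻¹ * D) _ fun i _ => ?_).trans (by simp)
  refine (ContinuousLinearMap.norm_iteratedFDeriv_comp_left _ (hq i) le_rfl).trans ?_
  rw [iteratedFDeriv_const_smul_apply (f := (fun y => f (y + δ • b i)) - f) ((hf2 i).sub hf1),
    iteratedFDeriv_sub_apply (hf2 i) hf1,
    iteratedFDeriv_comp_add_right, ContinuousLinearMap.norm_toSpanSingleton, b.orthonormal.1 i,
    one_mul, norm_smul, Real.norm_of_nonneg (inv_nonneg.2 hδ.le)]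
  exact mul_le_mul_of_nonneg_left (hD i) (inv_nonneg.2 hδ.le)

variable (b) in
theorem norm_sum_apply_smul (φ : E →L[ℝ] ℝ) : ‖∑ i, φ (b i) • b i‖ = ‖φ‖ := by
  classical
  have : FiniteDimensional ℝ E := b.toBasis.finiteDimensional_of_finite
  have h : ∑ i, φ (b i) • b i = (InnerProductSpace.toDual ℝ E).symm φ := by
    rw [← b.sum_repr' ((InnerProductSpace.toDual ℝ E).symm φ)]
    refine Finset.sum_congr rfl fun i _ => ?_
    rw [real_inner_comm, InnerProductSpace.toDual_symm_apply]
  rw [h, LinearIsometryEquiv.norm_map]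

/-- On the ball of radius `δ`, the forward-difference gradient with step `δ` has almost the same
norm as the differential at the centre. -/
theorem abs_norm_forwardDiffGradient_sub_le {f : E → ℝ} {s x : E} {r δ C : ℝ}
    (hf : ContDiffOn ℝ 2 f (ball s r)) (hC0 : 0 ≤ C)
    (hC : ∀ x ∈ ball s r, ‖iteratedFDeriv ℝ 2 f x‖ ≤ C)
    (hδ : 0 < δ) (hr : 2 * δ ≤ r) (hx : x ∈ ball s δ) :
    |‖forwardDiffGradient b δ f x‖ - ‖fderiv ℝ f s‖| ≤ Fintype.card ι * (2 * C * δ) := by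
  rw [← norm_sum_apply_smul b (fderiv ℝ f s)]
  refine (abs_norm_sub_norm_le _ _).trans ?_
  rw [forwardDiffGradient, ← Finset.sum_sub_distrib]
  refine (norm_sum_le_of_le (n := fun _ => 2 * C * δ) _ fun i _ => ?_).trans (by simp)
  have hsub : ball s (2 * δ) ⊆ ball s r := ball_subset_ball hr
  have h := (convex_ball s (2 * δ)).norm_image_sub_le_of_norm_fderiv_le' (𝕜 := ℝ) (f := f)
    (φ := fderiv ℝ f s) (C := C * (2 * δ)) (x := x) (y := x + δ • b i)
    (fun z hz => (hf.contDiffAt (isOpen_ball.mem_nhds (hsub hz))).differentiableAt (by norm_num))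
    (fun z hz => ?_) (ball_subset_ball (by linarith) hx) (add_smul_mem_ball hδ le_rfl hx i)
  · rw [← sub_smul, norm_smul, b.orthonormal.1 i, mul_one]
    rw [add_sub_cancel_left, map_smul, norm_smul, b.orthonormal.1 i, mul_one,
      Real.norm_of_nonneg hδ.le] at h
    have e : δ⁻¹ * (f (x + δ • b i) - f x) - fderiv ℝ f s (b i) =
        δ⁻¹ * (f (x + δ • b i) - f x - δ • fderiv ℝ f s (b i)) := by
      rw [smul_eq_mul]; field_simp
    rw [e, norm_mul, Real.norm_of_nonneg (inv_nonneg.2 hδ.le)]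
    calc _ ≤ δ⁻¹ * (C * (2 * δ) * δ) := mul_le_mul_of_nonneg_left h (inv_nonneg.2 hδ.le)
      _ = _ := by field_simp
  · refine (norm_fderiv_sub_fderiv_le hf hC (mem_ball_self (by linarith)) (hsub hz)).trans ?_
    gcongr
    rw [mem_ball, dist_eq_norm] at hz
    exact hz.le

end ForwardDifference

/-! ### Uniform estimates on one ball -/

section NormalisedEstimates

theorem exists_bound_iteratedFDeriv_of_isCompact {E F : Type*} [NormedAddCommGroup E]
    [NormedSpace ℝ E] [NormedAddCommGroup F] [NormedSpace ℝ F] {f : E → F} {W K : Set E} {m : ℕ}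
    (hW : IsOpen W) (hf : ContDiffOn ℝ m f W) (hK : IsCompact K) (hKW : K ⊆ W) :
    ∃ A : ℝ, 0 ≤ A ∧ ∀ k ≤ m, ∀ x ∈ K, ‖iteratedFDeriv ℝ k f x‖ ≤ A := by
  have h : ∀ k : ℕ, ∃ A : ℝ, k ≤ m → ∀ x ∈ K, ‖iteratedFDeriv ℝ k f x‖ ≤ A := fun k => by
    by_cases hk : k ≤ m
    · obtain ⟨A, hA⟩ := hK.exists_bound_of_continuousOn (f := iteratedFDeriv ℝ k f) fun x hx =>
        ((hf.contDiffAt (hW.mem_nhds (hKW hx))).continuousAt_iteratedFDeriv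
          (by exact_mod_cast hk)).continuousWithinAt
      exact ⟨A, fun _ => hA⟩
    · exact ⟨0, fun h => absurd h hk⟩
  choose A hA using h
  refine ⟨∑ k ∈ Finset.range (m + 1), |A k|, Finset.sum_nonneg fun _ _ => abs_nonneg _,
    fun k hk x hx => (hA k hk x hx).trans ((le_abs_self _).trans ?_)⟩
  exact Finset.single_le_sum (f := fun k => |A k|) (fun _ _ => abs_nonneg _)
    (Finset.mem_range.2 (Nat.lt_succ_of_le hk))

variable {E : Type*} [NormedAddCommGroup E] [InnerProductSpace ℝ E] {ι : Type*} [Fintype ι]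

theorem contDiffOn_inv_norm (m : ℕ) : ContDiffOn ℝ m (fun v : E => ‖v‖⁻¹) {0}ᶜ := fun _ hv =>
  ((contDiffAt_norm ℝ hv).inv (norm_ne_zero_iff.2 hv)).contDiffWithinAt

/-- The uniform estimates for `f / ‖q‖`, where `q` is the forward-difference gradient of `f`, in the
normalised case `‖df‖ = 1` at the centre `s` of the ball. The step `δ` and the bound `B` depend only
on `m`, on the radius and on the bound for the derivatives of `f` of order at least two. -/
theorem exists_uniform_bounds_of_norm_fderiv_eq_one (b : OrthonormalBasis ι ℝ E) {m : ℕ}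
    (hm : 2 ≤ m) {r C : ℝ} (hr : 0 < r) (hC0 : 0 ≤ C) :
    ∃ δ > 0, 2 * δ ≤ r ∧ ∃ B : ℝ, ∀ (f : E → ℝ) (s : E), ContDiffOn ℝ m f (ball s r) → f s = 0 →
      ‖fderiv ℝ f s‖ = 1 →
      (∀ x ∈ ball s r, ∀ k, 2 ≤ k → k ≤ m → ‖iteratedFDeriv ℝ k f x‖ ≤ C) →
      ∀ x ∈ ball s δ, forwardDiffGradient b δ f x ≠ 0 ∧
        (∀ k ≤ m, ‖iteratedFDeriv ℝ k (fun y => f y * ‖forwardDiffGradient b δ f y‖⁻¹) x‖ ≤ B) ∧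
        1 / 4 ≤ ‖fderiv ℝ (fun y => f y * ‖forwardDiffGradient b δ f y‖⁻¹) x‖ := by
  have : FiniteDimensional ℝ E := b.toBasis.finiteDimensional_of_finite
  set N : ℝ := (Fintype.card ι : ℝ) with hN
  have hN0 : 0 ≤ N := Nat.cast_nonneg _
  obtain ⟨δ, hδ, hδr, hδC, hδN⟩ : ∃ δ > 0, 2 * δ ≤ r ∧ (1 + C) * δ ≤ 1 / 16 ∧
      N * ((1 + C) * δ) ≤ 1 / 16 := by
    refine ⟨min (r / 2) (1 / (16 * (N + 1) * (1 + C))), by positivity, ?_, ?_, ?_⟩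
    · linarith [min_le_left (r / 2) (1 / (16 * (N + 1) * (1 + C)))]
    · calc _ ≤ (1 + C) * (1 / (16 * (N + 1) * (1 + C))) := by gcongr; exact min_le_right _ _
        _ = 1 / (16 * (N + 1)) := by field_simp
        _ ≤ 1 / 16 := by
          apply one_div_le_one_div_of_le <;> linarith
    · calc _ ≤ N * ((1 + C) * (1 / (16 * (N + 1) * (1 + C)))) := by gcongr; exact min_le_right _ _
        _ = N / (16 * (N + 1)) := by field_simp
        _ ≤ 1 / 16 := by
          rw [div_le_div_iff₀ (by positivity) (by norm_num)]; linarith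
  have hδ1 : δ ≤ 1 / 16 := by nlinarith
  obtain ⟨A, hA0, hA⟩ := exists_bound_iteratedFDeriv_of_isCompact (W := ({0}ᶜ : Set E))
    (K := closedBall 0 2 \ ball 0 (1 / 2)) isOpen_compl_singleton (contDiffOn_inv_norm m)
    ((isCompact_closedBall _ _).diff isOpen_ball) (by
      rintro v ⟨-, hv⟩ rfl
      exact hv (mem_ball_self (by norm_num)))
  set D : ℝ := max 1 (N * (δ⁻¹ * (2 * (2 + C)))) with hD
  refine ⟨δ, hδ, hδr, 2 ^ m * (2 + C) * (m.factorial * A * D ^ m), ?_⟩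
  intro f s hf hfs hs hfC x hx
  have hm2 : (2 : WithTop ℕ∞) ≤ m := by exact_mod_cast hm
  have hm1 : (m : WithTop ℕ∞) ≠ 0 := by
    have : m ≠ 0 := by omega
    exact_mod_cast this
  have hf2 : ContDiffOn ℝ 2 f (ball s r) := hf.of_le hm2
  have hC2 : ∀ x ∈ ball s r, ‖iteratedFDeriv ℝ 2 f x‖ ≤ C := fun x hx => hfC x hx 2 le_rfl hm
  have hsub : ball s δ ⊆ ball s r := ball_subset_ball (by linarith)
  have hss : s ∈ ball s r := mem_ball_self hr
  -- The first derivative, on the part of the ball that the forward differences see.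
  have hdf : ∀ y ∈ ball s (2 * δ), ‖fderiv ℝ f y - fderiv ℝ f s‖ ≤ 1 / 8 := fun y hy => by
    refine (norm_fderiv_sub_fderiv_le hf2 hC2 hss (ball_subset_ball hδr hy)).trans ?_
    rw [mem_ball, dist_eq_norm] at hy
    calc C * ‖y - s‖ ≤ (1 + C) * (2 * δ) := by gcongr; linarith
      _ ≤ _ := by linarith
  have hdf' : ∀ y ∈ ball s (2 * δ), ‖fderiv ℝ f y‖ ≤ 2 := fun y hy => by
    linarith [hdf y hy, norm_le_norm_sub_add (fderiv ℝ f y) (fderiv ℝ f s)]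
  have hf_lip : ∀ y ∈ ball s δ, ‖f y‖ ≤ 2 * δ := fun y hy => by
    have h := (convex_ball s δ).norm_image_sub_le_of_norm_fderiv_le (𝕜 := ℝ) (f := f) (C := 2)
      (fun z hz => (hf.contDiffAt (isOpen_ball.mem_nhds (hsub hz))).differentiableAt hm1)
      (fun z hz => hdf' z (ball_subset_ball (by linarith) hz)) (mem_ball_self hδ) hy
    rw [hfs, sub_zero] at h
    rw [mem_ball, dist_eq_norm] at hy
    linarith
  -- The forward-difference gradient `q` has norm close to `1`.
  set q := forwardDiffGradient b δ f with hq
  have hqn : ∀ y ∈ ball s δ, |‖q y‖ - 1| ≤ 1 / 8 := fun y hy => by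
    have := abs_norm_forwardDiffGradient_sub_le (b := b) hf2 hC0 hC2 hδ hδr hy
    rw [hs] at this
    refine this.trans ?_
    calc N * (2 * C * δ) ≤ 2 * (N * ((1 + C) * δ)) := by nlinarith [mul_nonneg hN0 hδ.le]
      _ ≤ _ := by linarith
  have hql : ∀ y ∈ ball s δ, 7 / 8 ≤ ‖q y‖ := fun y hy => by linarith [(abs_le.1 (hqn y hy)).1]
  have hqu : ∀ y ∈ ball s δ, ‖q y‖ ≤ 9 / 8 := fun y hy => by linarith [(abs_le.1 (hqn y hy)).2]
  have hq0 : ∀ y ∈ ball s δ, q y ≠ 0 := fun y hy h => by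
    have := hql y hy
    rw [h, norm_zero] at this
    linarith
  have hqc : ContDiffOn ℝ m q (ball s δ) := fun y hy =>
    (contDiffAt_forwardDiffGradient hf hδ hδr hy).contDiffWithinAt
  have hwc : ContDiffOn ℝ m (fun y => ‖q y‖⁻¹) (ball s δ) :=
    (contDiffOn_inv_norm m).comp hqc fun y hy => hq0 y hy
  have hfc : ContDiffOn ℝ m f (ball s δ) := hf.mono hsub
  -- Derivatives of order at least one: a crude bound, and a finer one in order one.
  have hfall : ∀ y ∈ ball s (2 * δ), ∀ k, 1 ≤ k → k ≤ m → ‖iteratedFDeriv ℝ k f y‖ ≤ 2 + C :=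
    fun y hy k h1 hk => by
      rcases h1.eq_or_lt with rfl | h2
      · rw [norm_iteratedFDeriv_one]; linarith [hdf' y hy]
      · linarith [hfC y (ball_subset_ball hδr hy) k h2 hk]
  have hx2 : x ∈ ball s (2 * δ) := ball_subset_ball (by linarith) hx
  have hqD : ∀ k, 1 ≤ k → k ≤ m → ‖iteratedFDeriv ℝ k q x‖ ≤ D ^ k := fun k h1 hk => by
    calc _ ≤ N * (δ⁻¹ * (2 * (2 + C))) :=
          norm_iteratedFDeriv_forwardDiffGradient_le hf hδ hδr hx hk fun i => by
            refine (norm_sub_le _ _).trans ?_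
            linarith [hfall _ (add_smul_mem_ball (b := b) hδ le_rfl hx i) k h1 hk,
              hfall x hx2 k h1 hk]
      _ ≤ D := le_max_right _ _
      _ ≤ D ^ k := le_self_pow₀ (le_max_left _ _) (by omega)
  have hqd : ‖fderiv ℝ q x‖ ≤ N * C := by
    rw [← norm_iteratedFDeriv_one]
    calc _ ≤ N * (δ⁻¹ * (C * δ)) :=
          norm_iteratedFDeriv_forwardDiffGradient_le hf hδ hδr hx (by omega) fun i => by
            have hxi := add_smul_mem_ball (b := b) hδ hδr hx i
            have h := norm_fderiv_sub_fderiv_le hf2 hC2 (hsub hx) hxi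
            rw [add_sub_cancel_left, norm_smul, b.orthonormal.1 i, mul_one,
              Real.norm_of_nonneg hδ.le] at h
            exact (norm_iteratedFDeriv_one_sub_le _ _ _).trans h
      _ = N * C := by field_simp
  refine ⟨hq0 x hx, fun k hk => ?_, ?_⟩
  · refine norm_iteratedFDeriv_mul_le_of_bound isOpen_ball hfc hwc hx (fun j hj => ?_)
      (fun j hj => ?_) hk
    · rcases Nat.eq_zero_or_pos j with rfl | h1
      · rw [norm_iteratedFDeriv_zero]
        linarith [hf_lip x hx]
      · exact hfall x hx2 j h1 hj
    · have h := norm_iteratedFDerivWithin_comp_le (n := j) (x := x) (C := A) (D := D)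
        (contDiffOn_inv_norm (E := E) m) hqc (by exact_mod_cast hj)
        isOpen_compl_singleton.uniqueDiffOn isOpen_ball.uniqueDiffOn (fun y hy => hq0 y hy) hx
        (fun i hi => by
          rw [iteratedFDerivWithin_of_isOpen i isOpen_compl_singleton (hq0 x hx)]
          refine hA i (hi.trans hj) _ ⟨?_, ?_⟩
          · rw [mem_closedBall_zero_iff]; linarith [hqu x hx]
          · rw [mem_ball_zero_iff]; linarith [hql x hx])
        (fun i h1 hi => by
          rw [iteratedFDerivWithin_of_isOpen i isOpen_ball hx]
          exact hqD i h1 (hi.trans hj))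
      rw [iteratedFDerivWithin_of_isOpen j isOpen_ball hx] at h
      refine h.trans ?_
      gcongr
      exact le_max_left _ _
  · set ρ : E → ℝ := fun y => f y * ‖q y‖⁻¹ with hρ
    have hρd : DifferentiableAt ℝ ρ x :=
      ((hfc.mul hwc).contDiffAt (isOpen_ball.mem_nhds hx)).differentiableAt hm1
    have hqd' : DifferentiableAt ℝ q x :=
      (hqc.contDiffAt (isOpen_ball.mem_nhds hx)).differentiableAt hm1
    have hnq : DifferentiableAt ℝ (fun y => ‖q y‖) x := hqd'.norm ℝ (hq0 x hx)
    have hnqd : ‖fderiv ℝ (fun y => ‖q y‖) x‖ ≤ N * C := by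
      have h1 : DifferentiableAt ℝ (norm : E → ℝ) (q x) :=
        (contDiffAt_norm (n := 1) ℝ (hq0 x hx)).differentiableAt (by norm_num)
      have : fderiv ℝ (fun y => ‖q y‖) x = (fderiv ℝ (norm : E → ℝ) (q x)).comp (fderiv ℝ q x) :=
        fderiv_comp x h1 hqd'
      rw [this]
      refine (ContinuousLinearMap.opNorm_comp_le _ _).trans ?_
      have h2 : ‖fderiv ℝ (norm : E → ℝ) (q x)‖ ≤ 1 := by
        simpa using norm_fderiv_le_of_lipschitz ℝ (x₀ := q x) (lipschitzWith_one_norm (E := E))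
      calc _ ≤ 1 * ‖fderiv ℝ q x‖ := by gcongr
        _ ≤ _ := by rw [one_mul]; exact hqd
    -- Differentiate `f = ρ * ‖q‖`, where `ρ` is small.
    have heq : f =ᶠ[nhds x] fun y => ρ y * ‖q y‖ := by
      filter_upwards [isOpen_ball.mem_nhds hx] with y hy
      rw [hρ]
      field_simp [norm_ne_zero_iff.2 (hq0 y hy)]
    have hfd : fderiv ℝ f x = ρ x • fderiv ℝ (fun y => ‖q y‖) x + ‖q x‖ • fderiv ℝ ρ x := by
      rw [heq.fderiv_eq, fderiv_fun_mul hρd hnq]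
    have hρx : ‖ρ x‖ ≤ 4 * δ := by
      rw [hρ, norm_mul, norm_inv, norm_norm]
      have : ‖q x‖⁻¹ ≤ 2 := by
        rw [inv_le_comm₀ (by linarith [hql x hx]) (by norm_num)]; linarith [hql x hx]
      calc _ ≤ 2 * δ * 2 := by gcongr; exact hf_lip x hx
        _ = _ := by ring
    have h1 : 7 / 8 ≤ ‖fderiv ℝ f x‖ := by
      have := norm_sub_norm_le (fderiv ℝ f s) (fderiv ℝ f x)
      rw [norm_sub_rev, hs] at this
      linarith [hdf x hx2]
    have h2 : ‖fderiv ℝ f x‖ ≤ 4 * δ * (N * C) + 9 / 8 * ‖fderiv ℝ ρ x‖ := by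
      rw [hfd]
      refine (norm_add_le _ _).trans ?_
      rw [norm_smul, norm_smul, norm_norm]
      gcongr
      exact hqu x hx
    have h3 : 4 * δ * (N * C) ≤ 1 / 4 := by nlinarith [mul_nonneg hN0 hδ.le]
    linarith

end NormalisedEstimates

/-! ### Renormalisation, and restriction of homogeneous functions to a hyperplane -/

section Renormalization

variable {E : Type*} [NormedAddCommGroup E] [InnerProductSpace ℝ E] {ι : Type*} [Fintype ι]

/-- A function `f` whose derivatives of order `2, …, m` on the ball of radius `r` about each zero
`s ∈ S` are controlled by `‖df(s)‖` can be multiplied by a positive weight, of size about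
`1 / ‖df(s)‖` near `s`, such that the product has bounded derivatives and a differential that is
bounded away from zero on a uniform neighbourhood of `S`. -/
theorem exists_uniform_renormalization (b : OrthonormalBasis ι ℝ E) {m : ℕ} (hm : 2 ≤ m)
    {f : E → ℝ} {S : Set E} {r C : ℝ} (hr : 0 < r) (hC0 : 0 ≤ C)
    (hf : ∀ s ∈ S, ContDiffOn ℝ m f (ball s r)) (hfS : ∀ s ∈ S, f s = 0)
    (hne : ∀ s ∈ S, fderiv ℝ f s ≠ 0)
    (hfC : ∀ s ∈ S, ∀ x ∈ ball s r, ∀ k, 2 ≤ k → k ≤ m →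
      ‖iteratedFDeriv ℝ k f x‖ ≤ C * ‖fderiv ℝ f s‖) :
    ∃ δ > 0, δ ≤ r ∧ ∃ w : E → ℝ, (∀ x ∈ thickening δ S, 0 < w x) ∧
      ContDiffOn ℝ m (fun x => f x * w x) (thickening δ S) ∧
      (∃ B : ℝ, ∀ k ≤ m, ∀ x ∈ thickening δ S, ‖iteratedFDeriv ℝ k (fun x => f x * w x) x‖ ≤ B) ∧
      ∀ x ∈ thickening δ S, 1 / 4 ≤ ‖fderiv ℝ (fun x => f x * w x) x‖ := by
  obtain ⟨δ, hδ, hδr, B, hB⟩ := exists_uniform_bounds_of_norm_fderiv_eq_one b hm hr hC0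
  have key : ∀ x ∈ thickening δ S, ∃ s ∈ S, x ∈ ball s δ ∧ forwardDiffGradient b δ f x ≠ 0 ∧
      (∀ k ≤ m, ‖iteratedFDeriv ℝ k (fun y => f y * ‖forwardDiffGradient b δ f y‖⁻¹) x‖ ≤ B) ∧
      1 / 4 ≤ ‖fderiv ℝ (fun y => f y * ‖forwardDiffGradient b δ f y‖⁻¹) x‖ := by
    intro x hx
    obtain ⟨s, hs, hxs⟩ := mem_thickening_iff.1 hx
    refine ⟨s, hs, hxs, ?_⟩
    set c : ℝ := ‖fderiv ℝ f s‖⁻¹ with hc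
    have hl : 0 < ‖fderiv ℝ f s‖ := norm_pos_iff.2 (hne s hs)
    have hc0 : 0 < c := inv_pos.2 hl
    have hfs : ContDiffAt ℝ m f s := (hf s hs).contDiffAt (isOpen_ball.mem_nhds (mem_ball_self hr))
    -- The quotient does not change when `f` is divided by `‖df(s)‖`.
    have hinv : (fun y => c * f y * ‖forwardDiffGradient b δ (fun y => c * f y) y‖⁻¹) =
        fun y => f y * ‖forwardDiffGradient b δ f y‖⁻¹ := by
      funext y
      rw [forwardDiffGradient_const_mul, norm_smul, Real.norm_of_nonneg hc0.le, mul_inv]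
      field_simp
    have h := hB (fun y => c * f y) s (contDiffOn_const.mul (hf s hs)) (by simp [hfS s hs]) ?_ ?_
      x hxs
    · rw [hinv, forwardDiffGradient_const_mul] at h
      exact ⟨right_ne_zero_of_smul h.1, h.2⟩
    · rw [fderiv_const_mul (hfs.differentiableAt (by
        have : m ≠ 0 := by omega
        exact_mod_cast this)), norm_smul, Real.norm_of_nonneg hc0.le, hc]
      exact inv_mul_cancel₀ hl.ne'
    · intro y hy k h2 hk
      have h1 : ContDiffAt ℝ k f y := ((hf s hs).contDiffAt (isOpen_ball.mem_nhds hy)).of_le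
        (by exact_mod_cast hk)
      have h3 : iteratedFDeriv ℝ k (fun y => c * f y) y = c • iteratedFDeriv ℝ k f y :=
        iteratedFDeriv_const_smul_apply (a := c) h1
      rw [h3, norm_smul, Real.norm_of_nonneg hc0.le]
      calc c * ‖iteratedFDeriv ℝ k f y‖ ≤ c * (C * ‖fderiv ℝ f s‖) := by
            gcongr; exact hfC s hs y hy k h2 hk
        _ = C := by rw [hc]; field_simp
  refine ⟨δ, hδ, by linarith, fun y => ‖forwardDiffGradient b δ f y‖⁻¹, fun x hx => ?_,
    fun x hx => ?_, ⟨B, fun k hk x hx => ?_⟩, fun x hx => ?_⟩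
  all_goals obtain ⟨s, hs, hxs, h0, h1, h2⟩ := key x hx
  · exact inv_pos.2 (norm_pos_iff.2 h0)
  · have hx' : x ∈ ball s r := ball_subset_ball (by linarith) hxs
    have hq := contDiffAt_forwardDiffGradient (b := b) (hf s hs) hδ hδr hxs
    exact (((hf s hs).contDiffAt (isOpen_ball.mem_nhds hx')).mul
      ((hq.norm ℝ h0).inv (norm_ne_zero_iff.2 h0))).contDiffWithinAt
  · exact h1 k hk
  · exact h2

end Renormalization

section Homogeneous

variable {E : Type*} [NormedAddCommGroup E] [NormedSpace ℝ E]
  {H : Type*} [NormedAddCommGroup H] [NormedSpace ℝ H]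

theorem norm_iteratedFDeriv_comp_affine_le {F : H → ℝ} {W : Set H} (hW : IsOpen W) {m k : ℕ}
    (hF : ContDiffOn ℝ m F W) (hk : k ≤ m) (L : E →L[ℝ] H) (a : H) {x : E} (hx : L x + a ∈ W) :
    ‖iteratedFDeriv ℝ k (fun x => F (L x + a)) x‖ ≤ ‖iteratedFDeriv ℝ k F (L x + a)‖ * ‖L‖ ^ k := by
  have hW' : IsOpen ((fun z => z + a) ⁻¹' W) := hW.preimage (by fun_prop)
  have hG : ContDiffOn ℝ m (fun z => F (z + a)) ((fun z => z + a) ⁻¹' W) :=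
    hF.comp (contDiff_id.add contDiff_const).contDiffOn fun _ h => h
  have hW'' : IsOpen (L ⁻¹' ((fun z => z + a) ⁻¹' W)) := hW'.preimage L.continuous
  have h := L.iteratedFDerivWithin_comp_right hG hW'.uniqueDiffOn hW''.uniqueDiffOn (x := x) hx
    (i := k) (by exact_mod_cast hk)
  rw [iteratedFDerivWithin_of_isOpen k hW'' hx, iteratedFDerivWithin_of_isOpen k hW' hx,
    iteratedFDeriv_comp_add_right] at h
  have h' := ContinuousMultilinearMap.norm_compContinuousLinearMap_le
    (iteratedFDeriv ℝ k F (L x + a)) (fun _ : Fin k => L)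
  rw [← h, Finset.prod_const, Finset.card_univ, Fintype.card_fin] at h'
  exact h'

/-- Euler's relation in degree zero. -/
theorem fderiv_apply_self_of_homogeneous {F : H → ℝ} (hF : ∀ t : ℝ, 0 < t → ∀ y, F (t • y) = F y)
    {u : H} (hu : DifferentiableAt ℝ F u) : fderiv ℝ F u u = 0 := by
  have h1 : HasDerivAt (fun t : ℝ => t • u) u 1 := by
    simpa using (hasDerivAt_id (1 : ℝ)).smul_const u
  have hu' : HasFDerivAt F (fderiv ℝ F u) ((1 : ℝ) • u) := by
    rw [one_smul]; exact hu.hasFDerivAt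
  have h2 : HasDerivAt (fun t : ℝ => F (t • u)) (fderiv ℝ F u u) 1 := hu'.comp_hasDerivAt 1 h1
  have h3 : HasDerivAt (fun t : ℝ => F (t • u)) 0 1 :=
    (hasDerivAt_const (1 : ℝ) (F u)).congr_of_eventuallyEq <| by
      filter_upwards [lt_mem_nhds (zero_lt_one (α := ℝ))] with t ht using hF t ht u
  exact h2.unique h3

/-- Restriction to the affine hyperplane `E × {1}` of a `C^m` function `F` that is homogeneous of
degree zero. At a point of size `R`, each derivative of the restriction gains a factor `R⁻¹`, while
by Euler's relation its differential is at least of size `R⁻²` wherever `dF ≠ 0`. Thus the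
derivatives of order at least two are controlled by the differential. -/
theorem exists_bounds_restrict_hyperplane [FiniteDimensional ℝ E] {m : ℕ} (hm : 2 ≤ m)
    {F : E × ℝ → ℝ} {W K : Set (E × ℝ)} (hW : IsOpen W) (hF : ContDiffOn ℝ m F W)
    (hK : IsCompact K) (hKW : K ⊆ W) (hne : ∀ u ∈ K, fderiv ℝ F u ≠ 0)
    (hhom : ∀ t : ℝ, 0 < t → ∀ y, F (t • y) = F y) :
    ∃ r > 0, ∃ C : ℝ, 0 ≤ C ∧ ∀ s : E, ‖(s, (1 : ℝ))‖⁻¹ • (s, (1 : ℝ)) ∈ K →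
      (∀ x ∈ ball s r, ‖(s, (1 : ℝ))‖⁻¹ • (x, (1 : ℝ)) ∈ W) ∧
      ContDiffOn ℝ m (fun x => F (x, 1)) (ball s r) ∧ fderiv ℝ (fun x => F (x, 1)) s ≠ 0 ∧
      ∀ x ∈ ball s r, ∀ k, 2 ≤ k → k ≤ m →
        ‖iteratedFDeriv ℝ k (fun x => F (x, 1)) x‖ ≤ C * ‖fderiv ℝ (fun x => F (x, 1)) s‖ := by
  have hm1 : (m : WithTop ℕ∞) ≠ 0 := by
    have : m ≠ 0 := by omega
    exact_mod_cast this
  obtain ⟨r, hr, hrW⟩ := hK.exists_cthickening_subset_open hW hKW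
  obtain ⟨A, hA0, hA⟩ := exists_bound_iteratedFDeriv_of_isCompact hW hF (hK.cthickening (r := r)) hrW
  obtain ⟨c, hc, hcK⟩ := hK.exists_forall_le' (f := fun u => ‖fderiv ℝ F u‖) (a := 0)
    (fun u hu => (((hF.fderiv_of_isOpen (m := 0) hW (by
      rw [zero_add]; exact_mod_cast (show 1 ≤ m by omega))).continuousOn.continuousAt
        (hW.mem_nhds (hKW hu))).norm).continuousWithinAt)
    (fun u hu => norm_pos_iff.2 (hne u hu))
  refine ⟨r, hr, 2 * A / c, by positivity, fun s hs => ?_⟩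
  set R : ℝ := ‖(s, (1 : ℝ))‖ with hR
  have hR1 : 1 ≤ R := by
    calc (1 : ℝ) = ‖(s, (1 : ℝ)).2‖ := by simp
      _ ≤ R := norm_snd_le _
  have hsR : ‖s‖ ≤ R := norm_fst_le (s, (1 : ℝ))
  have hR0 : 0 < R := by linarith
  -- By homogeneity the restriction is also `x ↦ F (R⁻¹ (x, 1))`; this places `s` on the unit sphere.
  set L : E →L[ℝ] E × ℝ := R⁻¹ • ContinuousLinearMap.inl ℝ E ℝ with hL
  set a : E × ℝ := R⁻¹ • ((0 : E), (1 : ℝ)) with ha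
  have hLx : ∀ x, L x + a = R⁻¹ • (x, (1 : ℝ)) := fun x => by simp [hL, ha]
  have hLn : ‖L‖ ≤ R⁻¹ := by
    rw [hL, norm_smul, Real.norm_of_nonneg (inv_nonneg.2 hR0.le)]
    exact mul_le_of_le_one_right (inv_nonneg.2 hR0.le) (ContinuousLinearMap.norm_inl_le_one ℝ E ℝ)
  have hfF : (fun x => F (x, 1)) = fun x => F (L x + a) := by
    funext x; rw [hLx, hhom _ (inv_pos.2 hR0)]
  have hball : ∀ x ∈ ball s r, L x + a ∈ cthickening r K := fun x hx => by
    refine mem_cthickening_of_dist_le _ _ _ _ hs ?_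
    rw [← hLx s, dist_eq_norm, add_sub_add_right_eq_sub, ← map_sub]
    rw [mem_ball, dist_eq_norm] at hx
    calc ‖L (x - s)‖ ≤ R⁻¹ * ‖x - s‖ := L.le_of_opNorm_le hLn _
      _ ≤ 1 * ‖x - s‖ := by gcongr; exact inv_le_one_of_one_le₀ hR1
      _ ≤ r := by linarith
  rw [hfF]
  have huW : L s + a ∈ W := by rw [hLx]; exact hKW hs
  have hFu : DifferentiableAt ℝ F (L s + a) := (hF.contDiffAt (hW.mem_nhds huW)).differentiableAt hm1
  set l : ℝ := ‖fderiv ℝ (fun x => F (L x + a)) s‖ with hl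
  have hchain : ∀ v, fderiv ℝ (fun x => F (L x + a)) s v = fderiv ℝ F (L s + a) (L v) := fun v => by
    have h1 : HasFDerivAt (fun x => L x + a) L s := L.hasFDerivAt.add_const a
    have h2 : HasFDerivAt (fun x => F (L x + a)) ((fderiv ℝ F (L s + a)).comp L) s :=
      hFu.hasFDerivAt.comp s h1
    rw [h2.fderiv]; rfl
  have hE : ∀ v : E, ‖fderiv ℝ F (L s + a) (v, 0)‖ ≤ R * l * ‖v‖ := fun v => by
    have h1 : (v, (0 : ℝ)) = R • L v := by simp [hL, smul_smul, hR0.ne']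
    rw [h1, map_smul, ← hchain, norm_smul, Real.norm_of_nonneg hR0.le, mul_assoc]
    gcongr
    exact ContinuousLinearMap.le_opNorm _ _
  -- By Euler's relation the transversal derivative is, up to sign, the derivative along `s`.
  have hT : ‖fderiv ℝ F (L s + a) (0, 1)‖ ≤ R * l * R := by
    have h0 := fderiv_apply_self_of_homogeneous hhom hFu
    have h1 : (s, (1 : ℝ)) = R • (L s + a) := by rw [hLx, smul_smul, mul_inv_cancel₀ hR0.ne', one_smul]
    have h2 : ((0 : E), (1 : ℝ)) = R • (L s + a) - (s, 0) := by rw [← h1]; simp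
    calc ‖fderiv ℝ F (L s + a) (0, 1)‖ = ‖fderiv ℝ F (L s + a) (s, 0)‖ := by
          rw [h2, map_sub, map_smul, h0, smul_zero, zero_sub, norm_neg]
      _ ≤ R * l * ‖s‖ := hE s
      _ ≤ _ := by gcongr
  have hcl : c ≤ 2 * R ^ 2 * l := by
    refine (hcK _ hs).trans ?_
    rw [← hLx]
    refine ContinuousLinearMap.opNorm_le_bound _ (by positivity) fun v => ?_
    have hv : v = (v.1, (0 : ℝ)) + v.2 • ((0 : E), (1 : ℝ)) := by ext <;> simp
    calc ‖fderiv ℝ F (L s + a) v‖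
        = ‖fderiv ℝ F (L s + a) (v.1, 0) + v.2 • fderiv ℝ F (L s + a) (0, 1)‖ := by
          rw [← map_smul, ← map_add, ← hv]
      _ ≤ R * l * ‖v.1‖ + ‖v.2‖ * (R * l * R) := by
          refine (norm_add_le _ _).trans ?_
          rw [norm_smul]
          gcongr
          exact hE _
      _ ≤ R * l * R * ‖v‖ + ‖v‖ * (R * l * R) := by
          have h1 : R * l ≤ R * l * R := le_mul_of_one_le_right (by positivity) hR1
          exact add_le_add (mul_le_mul h1 (norm_fst_le v) (norm_nonneg _) (by positivity))
            (mul_le_mul_of_nonneg_right (norm_snd_le v) (by positivity))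
      _ = 2 * R ^ 2 * l * ‖v‖ := by ring
  refine ⟨fun x hx => hLx x ▸ hrW (hball x hx), ?_, ?_, fun x hx k h2 hk => ?_⟩
  · exact hF.comp (L.contDiff.add contDiff_const).contDiffOn fun x hx => hrW (hball x hx)
  · intro h0
    rw [hl, h0, norm_zero, mul_zero] at hcl
    linarith
  · calc _ ≤ A * R⁻¹ ^ k := by
          refine (norm_iteratedFDeriv_comp_affine_le hW hF hk L a (hrW (hball x hx))).trans ?_
          gcongr
          exact hA k hk _ (hball x hx)
      _ ≤ A * R⁻¹ ^ 2 := by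
          gcongr A * ?_
          exact pow_le_pow_of_le_one (inv_nonneg.2 hR0.le) (inv_le_one_of_one_le₀ hR1) h2
      _ ≤ 2 * A / c * l := by
          rw [inv_pow, ← div_eq_mul_inv, div_mul_eq_mul_div, div_le_div_iff₀ (by positivity) hc]
          calc A * c ≤ A * (2 * R ^ 2 * l) := by gcongr
            _ = _ := by ring

end Homogeneous

/-! ### Homogeneous coordinates on projective space -/

namespace RPSpace

variable {n : ℕ}

/-- The identification of `ℝⁿ × ℝ` with the space `ℝⁿ⁺¹` of homogeneous coordinates; the last
coordinate comes from the second factor. -/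
noncomputable def homogeneousCoords (n : ℕ) : (EuclideanSpace ℝ (Fin n) × ℝ) ≃ₗ[ℝ] (Fin (n + 1) → ℝ) where
  toFun y := (Fin.last n).insertNth y.2 (fun j => y.1 j)
  invFun v := (WithLp.toLp 2 fun j => v ((Fin.last n).succAbove j), v (Fin.last n))
  map_add' y z := by
    funext i
    refine Fin.lastCases ?_ (fun j => ?_) i <;> simp
  map_smul' t y := by
    funext i
    refine Fin.lastCases ?_ (fun j => ?_) i <;> simp
  left_inv y := by
    ext <;> simp
  right_inv v := by
    funext i
    refine Fin.lastCases ?_ (fun j => ?_) i <;> simp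

theorem homogeneousCoords_ne_zero {y : EuclideanSpace ℝ (Fin n) × ℝ} :
    homogeneousCoords n y ≠ 0 ↔ y ≠ 0 :=
  (homogeneousCoords n).map_ne_zero_iff

theorem contDiff_homogeneousCoords {m : WithTop ℕ∞} : ContDiff ℝ m (homogeneousCoords n) :=
  (LinearMap.toContinuousLinearMap (homogeneousCoords n).toLinearMap).contDiff

theorem contDiff_homogeneousCoords_symm {m : WithTop ℕ∞} : ContDiff ℝ m (homogeneousCoords n).symm :=
  (LinearMap.toContinuousLinearMap (homogeneousCoords n).symm.toLinearMap).contDiff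

open Classical in
/-- The quotient map `ℝⁿ × ℝ → ℝℙⁿ`, `(x, t) ↦ [x : t]`; at the origin, where it is not defined,
its value is chosen to be `[0 : 1]`. -/
noncomputable def ofCoords (y : EuclideanSpace ℝ (Fin n) × ℝ) : RPSpace n :=
  if h : homogeneousCoords n y = 0 then affinePatch (Fin.last n) 0
  else Projectivization.mk ℝ (homogeneousCoords n y) h

theorem ofCoords_of_ne_zero {y : EuclideanSpace ℝ (Fin n) × ℝ} (h : homogeneousCoords n y ≠ 0) :
    ofCoords y = Projectivization.mk ℝ (homogeneousCoords n y) h := dif_neg h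

theorem ofCoords_one (x : EuclideanSpace ℝ (Fin n)) : ofCoords (x, 1) = canonicalEmbedding x :=
  ofCoords_of_ne_zero (insertNth_one_ne_zero (Fin.last n) fun j => x j)

theorem ofCoords_smul {t : ℝ} (ht : 0 < t) (y : EuclideanSpace ℝ (Fin n) × ℝ) :
    ofCoords (t • y) = ofCoords y := by
  by_cases h : homogeneousCoords n y = 0
  · rw [(homogeneousCoords n).map_eq_zero_iff.1 h, smul_zero]
  · have h' : homogeneousCoords n (t • y) ≠ 0 := by
      rw [map_smul]; exact smul_ne_zero ht.ne' h
    rw [ofCoords_of_ne_zero h, ofCoords_of_ne_zero h', Projectivization.mk_eq_mk_iff']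
    exact ⟨t, by rw [map_smul]⟩

/-- For `c ≠ 0`, the `i`-th chart lifts to the affine section `x ↦ c (x₁, …, 1, …, xₙ)`. The scale
`c` allows the section to pass through any prescribed vector. -/
theorem ofCoords_smul_symm_insertNth {c : ℝ} (hc : c ≠ 0) (i : Fin (n + 1))
    (x : EuclideanSpace ℝ (Fin n)) :
    ofCoords (c • (homogeneousCoords n).symm (i.insertNth 1 fun j => x j)) = affinePatch i x := by
  have h : homogeneousCoords n (c • (homogeneousCoords n).symm (i.insertNth 1 fun j => x j)) =
      c • (i.insertNth 1 fun j => x j : Fin (n + 1) → ℝ) := by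
    rw [map_smul, LinearEquiv.apply_symm_apply]
  have h' : homogeneousCoords n (c • (homogeneousCoords n).symm (i.insertNth 1 fun j => x j)) ≠ 0 := by
    rw [h]; exact smul_ne_zero hc (insertNth_one_ne_zero i _)
  rw [ofCoords_of_ne_zero h', affinePatch, Projectivization.mk_eq_mk_iff']
  exact ⟨c, h.symm⟩

/-- The affine coordinates, in the `i`-th chart, of the point with homogeneous coordinates `y`.
They are meaningful where the `i`-th homogeneous coordinate is nonzero. -/
noncomputable def affineCoords (i : Fin (n + 1)) (y : EuclideanSpace ℝ (Fin n) × ℝ) :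
    EuclideanSpace ℝ (Fin n) :=
  WithLp.toLp 2 fun j => homogeneousCoords n y (i.succAbove j) / homogeneousCoords n y i

theorem smul_symm_insertNth_affineCoords {i : Fin (n + 1)} {y : EuclideanSpace ℝ (Fin n) × ℝ}
    (h : homogeneousCoords n y i ≠ 0) :
    homogeneousCoords n y i •
      (homogeneousCoords n).symm (i.insertNth 1 fun j => affineCoords i y j) = y := by
  rw [← map_smul, LinearEquiv.symm_apply_eq]
  funext k
  refine i.succAboveCases ?_ (fun j => ?_) k
  · simp
  · simp only [affineCoords, Pi.smul_apply, Fin.insertNth_apply_succAbove, smul_eq_mul]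
    field_simp

theorem affinePatch_affineCoords {i : Fin (n + 1)} {y : EuclideanSpace ℝ (Fin n) × ℝ}
    (h : homogeneousCoords n y i ≠ 0) : affinePatch i (affineCoords i y) = ofCoords y := by
  rw [← ofCoords_smul_symm_insertNth h, smul_symm_insertNth_affineCoords h]

theorem contDiffAt_affineCoords {m : WithTop ℕ∞} {i : Fin (n + 1)}
    {y : EuclideanSpace ℝ (Fin n) × ℝ} (h : homogeneousCoords n y i ≠ 0) :
    ContDiffAt ℝ m (affineCoords i) y := by
  have hc : ∀ k, ContDiffAt ℝ m (fun y => homogeneousCoords n y k) y := fun k =>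
    (contDiff_pi.1 contDiff_homogeneousCoords k).contDiffAt
  rw [contDiffAt_euclidean]
  exact fun j => (hc _).div (hc i) h

theorem exists_homogeneousCoords_ne_zero {y : EuclideanSpace ℝ (Fin n) × ℝ} (hy : y ≠ 0) :
    ∃ i, homogeneousCoords n y i ≠ 0 :=
  Function.ne_iff.1 (homogeneousCoords_ne_zero.2 hy)

theorem contDiff_insertNth_one {m : WithTop ℕ∞} (i : Fin (n + 1)) :
    ContDiff ℝ m fun x : EuclideanSpace ℝ (Fin n) => (i.insertNth 1 fun j => x j : Fin (n + 1) → ℝ) := by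
  rw [contDiff_pi]
  intro k
  refine i.succAboveCases ?_ (fun j => ?_) k
  · simpa using contDiff_const
  · simp only [Fin.insertNth_apply_succAbove]
    exact (contDiff_euclidean.1 contDiff_id) j

theorem continuous_affinePatch (i : Fin (n + 1)) : Continuous (affinePatch (n := n) i) := by
  have h : Continuous fun x : EuclideanSpace ℝ (Fin n) =>
      (⟨i.insertNth 1 fun j => x j, insertNth_one_ne_zero i fun j => x j⟩ :
        {v : Fin (n + 1) → ℝ // v ≠ 0}) :=
    (contDiff_insertNth_one (m := 0) i).continuous.subtype_mk _
  exact continuous_quot_mk.comp h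

theorem eventually_affinePatch_affineCoords {i : Fin (n + 1)}
    {y : EuclideanSpace ℝ (Fin n) × ℝ} (h : homogeneousCoords n y i ≠ 0) :
    ∀ᶠ z in nhds y, affinePatch i (affineCoords i z) = ofCoords z := by
  have : ContinuousAt (fun y => homogeneousCoords n y i) y :=
    (contDiff_pi.1 (contDiff_homogeneousCoords (m := 0)) i).continuous.continuousAt
  filter_upwards [this.eventually_ne h] with z hz using affinePatch_affineCoords hz

theorem continuousAt_ofCoords {y : EuclideanSpace ℝ (Fin n) × ℝ} (hy : y ≠ 0) :
    ContinuousAt ofCoords y := by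
  obtain ⟨i, hi⟩ := exists_homogeneousCoords_ne_zero hy
  have hc : ContinuousAt (affineCoords i) y := (contDiffAt_affineCoords (m := 0) hi).continuousAt
  refine ((continuous_affinePatch i).continuousAt.comp hc).congr
    (eventually_affinePatch_affineCoords hi)

namespace IsDefiningFunction

variable {m : ℕ} {Ω U : Set (RPSpace n)} {ρ : RPSpace n → ℝ}

theorem contDiffAt_comp_ofCoords (h : IsDefiningFunction m Ω U ρ)
    {y : EuclideanSpace ℝ (Fin n) × ℝ} (hy : y ≠ 0) (hyU : ofCoords y ∈ U) :
    ContDiffAt ℝ m (ρ ∘ ofCoords) y := by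
  obtain ⟨i, hi⟩ := exists_homogeneousCoords_ne_zero hy
  have hmem : affineCoords i y ∈ affinePatch i ⁻¹' U := by
    rw [Set.mem_preimage, affinePatch_affineCoords hi]; exact hyU
  have h1 : ContDiffAt ℝ m (ρ ∘ affinePatch i) (affineCoords i y) :=
    (h.contDiffOn i).contDiffAt ((h.isOpen_nhd.preimage (continuous_affinePatch i)).mem_nhds hmem)
  refine (h1.comp y (contDiffAt_affineCoords hi)).congr_of_eventuallyEq ?_
  filter_upwards [eventually_affinePatch_affineCoords hi] with z hz
  simp [hz]

theorem fderiv_comp_ofCoords_ne_zero (h : IsDefiningFunction m Ω U ρ) (hm : m ≠ 0)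
    {y : EuclideanSpace ℝ (Fin n) × ℝ} (hy : y ≠ 0) (hyf : ofCoords y ∈ frontier Ω) :
    fderiv ℝ (ρ ∘ ofCoords) y ≠ 0 := by
  obtain ⟨i, hi⟩ := exists_homogeneousCoords_ne_zero hy
  intro h0
  refine h.differential_ne_zero i (affineCoords i y)
    (by rw [affinePatch_affineCoords hi]; exact hyf) ?_
  -- In the `i`-th chart `ρ` is the composition of its lift with an affine section through `y`.
  set σ : EuclideanSpace ℝ (Fin n) → EuclideanSpace ℝ (Fin n) × ℝ := fun x =>
    homogeneousCoords n y i • (homogeneousCoords n).symm (i.insertNth 1 fun j => x j) with hσ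
  have hσy : σ (affineCoords i y) = y := smul_symm_insertNth_affineCoords hi
  have heq : ρ ∘ affinePatch i = (ρ ∘ ofCoords) ∘ σ := by
    funext x
    simp only [Function.comp_apply, hσ, ofCoords_smul_symm_insertNth hi]
  have hσd : DifferentiableAt ℝ σ (affineCoords i y) := by
    have h1 : ContDiff ℝ 1 σ := (contDiff_const_smul (homogeneousCoords n y i)).comp
      (contDiff_homogeneousCoords_symm.comp (contDiff_insertNth_one i))
    exact h1.contDiffAt.differentiableAt (by norm_num)
  have hd : DifferentiableAt ℝ (ρ ∘ ofCoords) (σ (affineCoords i y)) := by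
    rw [hσy]
    exact (h.contDiffAt_comp_ofCoords hy (h.frontier_subset hyf)).differentiableAt
      (by exact_mod_cast hm)
  rw [heq, fderiv_comp _ hd hσd, hσy, h0, ContinuousLinearMap.zero_comp]

end IsDefiningFunction

end RPSpace

/-! ### The uniformly `C^m` defining function -/

theorem mainTheorem3 (n m : ℕ) (hm : 2 ≤ m) (Ω' : Set (RPSpace n))
    (hΩ' : RPSpace.IsCmDomain m Ω') :
    ∃ (U : Set (EuclideanSpace ℝ (Fin n))) (ρ : EuclideanSpace ℝ (Fin n) → ℝ),
      IsUniformDefiningFunction m (RPSpace.canonicalEmbedding ⁻¹' Ω') U ρ := by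
  obtain ⟨V, ρ', h⟩ := hΩ'
  have hm0 : m ≠ 0 := by omega
  set Ω : Set (EuclideanSpace ℝ (Fin n)) := RPSpace.canonicalEmbedding ⁻¹' Ω' with hΩ
  have hι : Continuous (RPSpace.canonicalEmbedding (n := n)) :=
    RPSpace.continuous_affinePatch (Fin.last n)
  have hΩo : IsOpen Ω := h.isOpen_domain.preimage hι
  have hfr : frontier Ω ⊆ RPSpace.canonicalEmbedding ⁻¹' frontier Ω' :=
    hι.frontier_preimage_subset Ω'
  set f : EuclideanSpace ℝ (Fin n) → ℝ := ρ' ∘ RPSpace.canonicalEmbedding with hf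
  have hVo : IsOpen (RPSpace.canonicalEmbedding (n := n) ⁻¹' V) := h.isOpen_nhd.preimage hι
  have hneg : ∀ x, RPSpace.canonicalEmbedding x ∈ V → (f x < 0 ↔ x ∈ Ω) := fun x hx => by
    have := Set.ext_iff.1 h.neg_iff (RPSpace.canonicalEmbedding x)
    simpa [hx, hf, hΩ] using this
  -- `f` is nonnegative off `Ω`, and at boundary points it is a limit of negative values.
  have hf0 : ∀ s ∈ frontier Ω, f s = 0 := fun s hs => by
    have hsV : RPSpace.canonicalEmbedding s ∈ V := h.frontier_subset (hfr hs)
    have hsΩ : s ∉ Ω := by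
      rw [hΩo.frontier_eq] at hs; exact hs.2
    have hfs : ContinuousAt f s :=
      (h.contDiffOn (Fin.last n)).continuousOn.continuousAt (hVo.mem_nhds hsV)
    refine le_antisymm ?_ (not_lt.1 fun hlt => hsΩ ((hneg s hsV).1 hlt))
    by_contra! hpos
    obtain ⟨x, ⟨hx0, hxV⟩, hxΩ⟩ := mem_closure_iff_nhds.1 (frontier_subset_closure hs) _
      (Filter.inter_mem (hfs.preimage_mem_nhds (lt_mem_nhds hpos)) (hVo.mem_nhds hsV))
    exact lt_asymm hx0 ((hneg x hxV).2 hxΩ)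
  -- The lift of `ρ'` to homogeneous coordinates, and the compact set of unit vectors over `∂Ω'`.
  set F : EuclideanSpace ℝ (Fin n) × ℝ → ℝ := ρ' ∘ RPSpace.ofCoords with hF
  have hcont : ContinuousOn (RPSpace.ofCoords (n := n)) {0}ᶜ := fun y hy =>
    (RPSpace.continuousAt_ofCoords hy).continuousWithinAt
  have hsph : sphere (0 : EuclideanSpace ℝ (Fin n) × ℝ) 1 ⊆ {0}ᶜ := fun y hy =>
    ne_zero_of_mem_unit_sphere ⟨y, hy⟩
  set K : Set (EuclideanSpace ℝ (Fin n) × ℝ) := sphere 0 1 ∩ RPSpace.ofCoords ⁻¹' frontier Ω' with hK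
  have hKc : IsCompact K := (isCompact_sphere _ _).of_isClosed_subset
    ((hcont.mono hsph).preimage_isClosed_of_isClosed isClosed_sphere isClosed_frontier)
    Set.inter_subset_left
  obtain ⟨r, hr, C, hC0, hC⟩ := exists_bounds_restrict_hyperplane hm (F := F) (K := K)
    (hcont.isOpen_inter_preimage isOpen_compl_singleton h.isOpen_nhd)
    (fun y hy => (h.contDiffAt_comp_ofCoords hy.1 hy.2).contDiffWithinAt) hKc
    (fun y hy => ⟨hsph hy.1, h.frontier_subset hy.2⟩)
    (fun y hy => h.fderiv_comp_ofCoords_ne_zero hm0 (hsph hy.1) hy.2)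
    (fun t ht y => by simp [hF, RPSpace.ofCoords_smul ht])
  have hFf : (fun x => F (x, 1)) = f := by
    funext x; simp [hF, hf, RPSpace.ofCoords_one]
  rw [hFf] at hC
  have hsK : ∀ s ∈ frontier Ω, ‖(s, (1 : ℝ))‖⁻¹ • (s, (1 : ℝ)) ∈ K := fun s hs => by
    have h0 : ‖(s, (1 : ℝ))‖ ≠ 0 := by
      rw [norm_ne_zero_iff]; intro h; simpa using congrArg Prod.snd h
    refine ⟨?_, ?_⟩
    · rw [mem_sphere_zero_iff_norm, norm_smul, norm_inv, norm_norm, inv_mul_cancel₀ h0]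
    · rw [Set.mem_preimage, RPSpace.ofCoords_smul (by positivity), RPSpace.ofCoords_one]
      exact hfr hs
  obtain ⟨δ, hδ, hδr, w, hw, hρ, ⟨B, hB⟩, hg⟩ := exists_uniform_renormalization
    (EuclideanSpace.basisFun (Fin n) ℝ) hm hr hC0 (fun s hs => (hC s (hsK s hs)).2.1) hf0
    (fun s hs => (hC s (hsK s hs)).2.2.1) (fun s hs => (hC s (hsK s hs)).2.2.2)
  have hUV : ∀ x ∈ thickening δ (frontier Ω), RPSpace.canonicalEmbedding x ∈ V := fun x hx => by
    obtain ⟨s, hs, hxs⟩ := mem_thickening_iff.1 hx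
    have h1 := ((hC s (hsK s hs)).1 x (ball_subset_ball hδr hxs)).2
    have h0 : 0 < ‖(s, (1 : ℝ))‖ := by
      rw [norm_pos_iff]; intro h; simpa using congrArg Prod.snd h
    rwa [Set.mem_preimage, RPSpace.ofCoords_smul (inv_pos.2 h0), RPSpace.ofCoords_one] at h1
  have hgrad : ∀ x ∈ thickening δ (frontier Ω), 1 / 4 ≤ ‖gradient (fun x => f x * w x) x‖ :=
    fun x hx => by rw [gradient, LinearIsometryEquiv.norm_map]; exact hg x hx
  have hsub : frontier Ω ⊆ thickening δ (frontier Ω) := self_subset_thickening hδ _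
  exact ⟨thickening δ (frontier Ω), fun x => f x * w x,
    { isOpen_domain := hΩo
      isOpen_nhd := isOpen_thickening
      frontier_subset := hsub
      contDiffOn := hρ
      neg_iff := by
        ext x
        constructor
        · rintro ⟨hx, hx0⟩
          exact ⟨(hneg x (hUV x hx)).1 (neg_of_mul_neg_left hx0 (hw x hx).le), hx⟩
        · rintro ⟨hxΩ, hx⟩
          exact ⟨hx, mul_neg_of_neg_of_pos ((hneg x (hUV x hx)).2 hxΩ) (hw x hx)⟩
      gradient_ne_zero := fun x hx h0 => by
        have := hgrad x (hsub hx)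
        rw [h0, norm_zero] at this
        linarith
      dist_pos := ⟨δ, hδ, fun x hx y hy => by
        rw [isOpen_thickening.frontier_eq] at hy
        by_contra! hxy
        exact hy.2 (mem_thickening_iff.2 ⟨x, hx, by rwa [dist_comm]⟩)⟩
      norm_finite := ⟨B, hB⟩
      gradient_bound := ⟨1 / 4, by norm_num, hgrad⟩ }⟩
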